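/- Let $X=S^1\times\mathbb{R}$ with $S^1=\mathbb{R}/\mathbb{Z}$, let $\pi:\mathbb{R}^2\to X$ be the natural projection, and let $f:X\to X$ be a $C^1$ diffeomorphism that preserves the orientation and each of the two ends of $X$, preserves the area of some (continuous) Riemannian metric on $X$, and satisfies the twist condition $\partial F_1/\partial y>0$ on $\mathbb{R}^2$, where $F=(F_1,F_2):\mathbb{R}^2\to\mathbb{R}^2$ is a lifting of $f$. Let $a,b\in\mathbb{R}$ and let $\phi_t:\mathbb{R}\to\mathbb{R}$, $t\in[a,b]$, be continuous functions of period $1$ such that $\phi_t(x)$ is continuous as a function of $(t,x)\in[a,b]\times\mathbb{R}$. Suppose that for each $t$ the curve $\Gamma_t=\{\pi(x,\phi_t(x)):0\le x\le 1\}$ satisfies $f(\Gamma_t)=\Gamma_t$ (so $\Gamma_t$ is an invariant rotational circle of $f$), and that $\Gamma_s\cap\Gamma_t=\emptyset$ whenever $s\neq t$. Then there is a continuous, strictly monotone (strictly increasing or strictly decreasing) function $r:[a,b]\to\mathbb{R}$ such that $$\rho(\Gamma_t)=r(t)\ (\mathrm{mod}\ 1)\qquad\text{for all } t\in[a,b].$$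 Here $\rho(\Gamma_t)\in\mathbb{R}/\mathbb{Z}$ is the rotation number of $f|_{\Gamma_t}$: identify $\Gamma_t$ with $S^1$ by the projection to the first coordinate; then $f|_{\Gamma_t}$ becomes an orientation preserving circle homeomorphism, and $\rho(\Gamma_t)$ is the class mod $1$ of $\lim_{k\to\infty}(g^k(x)-x)/k$ for any lifting $g:\mathbb{R}\to\mathbb{R}$ of it. -/

import Mathlib

open Set Filter Topology MeasureTheory

/-- The cylinder `S¹ × ℝ`, where `S¹ = ℝ / ℤ`. -/
abbrev Cylinder : Type := UnitAddCircle × ℝ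

/-- The natural projection `ℝ² → S¹ × ℝ`. -/
def cylProj (p : ℝ × ℝ) : Cylinder := ((p.1 : UnitAddCircle), p.2)

/-- `F : ℝ² → ℝ²` is a (continuous) lifting of `f : S¹ × ℝ → S¹ × ℝ`. -/
def IsCylLift (F : ℝ × ℝ → ℝ × ℝ) (f : Cylinder → Cylinder) : Prop :=
  Continuous F ∧ ∀ p, cylProj (F p) = f (cylProj p)

/-- `f` is of class `C¹`. The projection `ℝ² → S¹ × ℝ` is a smooth covering and local
diffeomorphism, so this means that `f` has a lifting of class `C¹`. -/
def IsCylC1 (f : Cylinder → Cylinder) : Prop :=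
  ∃ F : ℝ × ℝ → ℝ × ℝ, IsCylLift F f ∧ ContDiff ℝ 1 F

/-- A (continuous) Riemannian metric on the cylinder, given by its Gram matrix in the global frame
of the two coordinate vector fields. -/
structure CylMetric where
  gram : Cylinder → Matrix (Fin 2) (Fin 2) ℝ
  continuous_gram : Continuous gram
  posDef_gram : ∀ z, (gram z).PosDef

/-- The area measure `√(det g) dx dy` of a Riemannian metric on the cylinder. -/
noncomputable def CylMetric.area (g : CylMetric) : Measure Cylinder :=
  (volume : Measure Cylinder).withDensity fun z => ENNReal.ofReal (Real.sqrt (g.gram z).det)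

/-- Twist maps of the cylinder: `C¹` diffeomorphisms that preserve the orientation, each of the two
ends, and the area of some Riemannian metric, and that satisfy the twist condition. The derivative
of a lifting is the differential of `f` in the coordinate frame; it does not depend on the lifting,
because two liftings differ by an integer translation. -/
structure IsTwistMap (f : Cylinder ≃ₜ Cylinder) : Prop where
  contDiff : IsCylC1 f
  contDiff_symm : IsCylC1 f.symm
  orientation : ∀ F, IsCylLift F f → ∀ p, 0 < (fderiv ℝ F p).det
  tendsto_top : Tendsto (fun z => (f z).2) (comap Prod.snd atTop) atTop
  tendsto_bot : Tendsto (fun z => (f z).2) (comap Prod.snd atBot) atBot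
  area : ∃ g : CylMetric, MeasurePreserving f g.area g.area
  twist : ∀ F, IsCylLift F f → ∀ p, 0 < (fderiv ℝ F p (0, 1)).1

/-- The curve in the cylinder parametrized by `x ↦ (x mod 1, φ x)`, `0 ≤ x ≤ 1`. -/
def cylGraph (φ : ℝ → ℝ) : Set Cylinder := (fun x => cylProj (x, φ x)) '' Icc 0 1

/-- `φ` defines an invariant rotational circle of `f`. -/
structure IsInvariantRotationalCircle (f : Cylinder → Cylinder) (φ : ℝ → ℝ) : Prop where
  continuous : Continuous φ
  periodic : Function.Periodic φ 1
  invariant : f '' cylGraph φ = cylGraph φ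

/-- `h` is an orientation preserving circle homeomorphism whose rotation number is `ρ`: it has a
continuous strictly increasing lifting `G` with `G (x + 1) = G x + 1`, and the class mod `1` of
`lim (G^k x - x) / k` is `ρ`. -/
def HasRotationNumber (h : UnitAddCircle → UnitAddCircle) (ρ : UnitAddCircle) : Prop :=
  ∃ G : CircleDeg1Lift, Continuous G ∧ StrictMono G ∧
    (∀ x : ℝ, ((G x : ℝ) : UnitAddCircle) = h (x : UnitAddCircle)) ∧
    ((G.translationNumber : ℝ) : UnitAddCircle) = ρ

/-- The restriction of `f` to the invariant circle `Γ` (a graph over `S¹`, oriented by the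
projection to `S¹`) preserves the orientation and has rotation number `ρ`. Here `h` is the circle
map `π₁ ∘ f|Γ ∘ (π₁|Γ)⁻¹`. -/
def HasRotationNumberOn (f : Cylinder → Cylinder) (Γ : Set Cylinder) (ρ : UnitAddCircle) : Prop :=
  ∃ h : UnitAddCircle → UnitAddCircle, (∀ z ∈ Γ, h z.1 = (f z).1) ∧ HasRotationNumber h ρ

/-! A lifting of `f` induces on each invariant circle a circle lifting of degree one, and `r t` is
its translation number. It is continuous in `t` as a uniform limit of `(g^n 0) / n`. Disjoint
circles are strictly ordered by height, and the twist makes the circle lifting of a higher one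
pointwise larger, so `r` is weakly monotone in height.

Strictness is where area enters. If two circles shared a translation number, the uniform gap between
their liftings and Dirichlet approximation would make it a rational `p / q`
(`exists_mul_translationNumber_eq_int`). Every circle in between would have the same number, hence a
point that the `q`-th iterate moves by exactly `p`. In `exists_forall_pow_circleLift_ne` an open box
between two of the circles is then pushed to the right off itself, while the periodic point on each
circle stops it from coming round to the box again. This contradicts Poincaré recurrence on the
compact annulus swept by the circles. -/

/-! ### Liftings and their degree. -/

theorem unitAddCircle_coe_eq_iff {x y : ℝ} :
    (x : UnitAddCircle) = y ↔ ∃ n : ℤ, x = y + n := by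
  rw [← sub_eq_zero, ← AddCircle.coe_sub, AddCircle.coe_eq_zero_iff]
  refine exists_congr fun n => ?_
  rw [zsmul_eq_mul, mul_one]
  constructor <;> intro h <;> linarith

theorem cylProj_eq_iff {p q : ℝ × ℝ} :
    cylProj p = cylProj q ↔ ∃ n : ℤ, p = (q.1 + n, q.2) := by
  simp only [cylProj, unitAddCircle_coe_eq_iff, Prod.ext_iff, exists_and_right]

theorem cylProj_add_int (x y : ℝ) (n : ℤ) : cylProj (x + n, y) = cylProj (x, y) :=
  cylProj_eq_iff.2 ⟨n, rfl⟩

theorem continuous_cylProj : Continuous cylProj :=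
  ((AddCircle.continuous_mk' (1 : ℝ)).comp continuous_fst).prodMk continuous_snd

theorem isOpenMap_cylProj : IsOpenMap cylProj :=
  (QuotientAddGroup.isOpenMap_coe (G := ℝ)).prodMap IsOpenMap.id

/-- Two continuous maps with the same projection to the cylinder differ by an integer
translation. -/
theorem exists_eq_add_int_of_cylProj_eq {A B : ℝ × ℝ → ℝ × ℝ} (hA : Continuous A)
    (hB : Continuous B) (h : ∀ p, cylProj (A p) = cylProj (B p)) :
    ∃ n : ℤ, ∀ p, A p = ((B p).1 + n, (B p).2) := by
  choose n hn using fun p => cylProj_eq_iff.1 (h p)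
  have hcont : Continuous n := by
    rw [Int.isClosedEmbedding_coe_real.isInducing.continuous_iff]
    have : ((↑) : ℤ → ℝ) ∘ n = fun p => (A p).1 - (B p).1 := by
      funext p
      have := congrArg Prod.fst (hn p)
      simp only [Function.comp_apply]
      simp only at this
      linarith
    rw [this]
    fun_prop
  refine ⟨n 0, fun p => ?_⟩
  rw [← PreconnectedSpace.constant inferInstance hcont (x := p) (y := 0)]
  exact hn p

/-- A lifting intertwines the integer translations with their multiples by the degree. -/
theorem IsCylLift.exists_degree {F : ℝ × ℝ → ℝ × ℝ} {f : Cylinder → Cylinder}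
    (hF : IsCylLift F f) :
    ∃ d : ℤ, ∀ (n : ℤ) (x y : ℝ), F (x + n, y) = ((F (x, y)).1 + n * d, (F (x, y)).2) := by
  obtain ⟨d, hd⟩ := exists_eq_add_int_of_cylProj_eq (A := fun p => F (p.1 + 1, p.2)) (B := F)
    (hF.1.comp (by fun_prop)) hF.1 fun p => by
      rw [hF.2, hF.2]
      exact congrArg f (by simpa using cylProj_add_int p.1 p.2 1)
  have hd' : ∀ x y, F (x + 1, y) = ((F (x, y)).1 + d, (F (x, y)).2) := fun x y => hd (x, y)
  refine ⟨d, fun n => ?_⟩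
  induction n using Int.induction_on with
  | zero => simp
  | succ i ih =>
    intro x y
    have := hd' (x + i) y
    have h2 := ih x y
    push_cast at h2 ⊢
    rw [← add_assoc, this, h2]
    ext <;> simp
    ring
  | pred i ih =>
    intro x y
    have := hd' (x + (-(i : ℝ) - 1)) y
    have h2 := ih x y
    push_cast at h2 ⊢
    rw [show x + (-(i : ℝ) - 1) + 1 = x + -i by ring, h2] at this
    rw [Prod.ext_iff] at this ⊢
    simp only at this ⊢
    constructor
    · linarith [this.1]
    · exact this.2.symm

/-- A `C¹` diffeomorphism of the cylinder has a `C¹` lifting with a `C¹` right inverse, of degree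
`1` or `-1`. -/
theorem exists_lift_rightInverse {f : Cylinder ≃ₜ Cylinder} (h : IsCylC1 f)
    (h' : IsCylC1 f.symm) :
    ∃ (F G : ℝ × ℝ → ℝ × ℝ) (d : ℤ), IsCylLift F f ∧ ContDiff ℝ 1 F ∧
      IsCylLift G f.symm ∧ ContDiff ℝ 1 G ∧ (∀ p, F (G p) = p) ∧ d ≠ 0 ∧ (0 < d → d = 1) ∧
      ∀ (n : ℤ) (x y : ℝ), F (x + n, y) = ((F (x, y)).1 + n * d, (F (x, y)).2) := by
  obtain ⟨F, hF, hFc⟩ := h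
  obtain ⟨F', hF', hFc'⟩ := h'
  obtain ⟨d, hd⟩ := hF.exists_degree
  obtain ⟨d', hd'⟩ := hF'.exists_degree
  obtain ⟨k, hk⟩ := exists_eq_add_int_of_cylProj_eq (A := fun p => F (F' p)) (B := id)
    (hF.1.comp hF'.1) continuous_id fun p => by
      rw [hF.2, hF'.2, f.apply_symm_apply]; rfl
  have hdd : d' * d = 1 := by
    have h1 := hk (0 + (1 : ℤ), 0)
    have h2 := hk (0, 0)
    simp only [hd', id, Prod.ext_iff] at h1 h2
    have : ((1 : ℤ) * d' : ℝ) = ((1 * d' : ℤ) : ℝ) := by push_cast; ring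
    rw [this, hd] at h1
    have h3 : ((d' * d : ℤ) : ℝ) = (1 : ℤ) := by
      push_cast at h1 h2 ⊢
      linarith [h1.1, h2.1]
    exact_mod_cast h3
  -- `F ∘ F'` is the translation by `k`; precomposing `F'` with the opposite translation makes it a
  -- right inverse.
  refine ⟨F, fun p => F' (p.1 - k, p.2), d, hF, hFc, ⟨hF'.1.comp (by fun_prop), fun p => ?_⟩,
    hFc'.comp (by fun_prop), fun p => ?_, ?_, fun h0 => ?_, hd⟩
  · rw [hF'.2]
    congr 1
    have := cylProj_add_int p.1 p.2 (-k)
    push_cast at this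
    rwa [← sub_eq_add_neg] at this
  · have := hk (p.1 - k, p.2)
    simp only [id] at this
    rw [this]
    simp
  · rintro rfl
    simp at hdd
  · exact Int.eq_one_or_neg_one_of_mul_eq_one (by rwa [mul_comm] at hdd) |>.resolve_right (by omega)

theorem IsCylLift.injective {f : Cylinder ≃ₜ Cylinder} {F : ℝ × ℝ → ℝ × ℝ} {d : ℤ}
    (hF : IsCylLift F f) (hd0 : d ≠ 0)
    (hd : ∀ (n : ℤ) (x y : ℝ), F (x + n, y) = ((F (x, y)).1 + n * d, (F (x, y)).2)) :
    Function.Injective F := by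
  intro p q hpq
  have h1 : f (cylProj p) = f (cylProj q) := by rw [← hF.2, ← hF.2, hpq]
  obtain ⟨n, hn⟩ := cylProj_eq_iff.1 (f.injective h1)
  rw [hn, hd, Prod.ext_iff] at hpq
  have h2 : ((n * d : ℤ) : ℝ) = (0 : ℤ) := by
    have := hpq.1
    push_cast
    simp only [Prod.mk.eta] at this
    linarith
  have h3 : n = 0 := by
    have : n * d = 0 := by exact_mod_cast h2
    exact (mul_eq_zero.1 this).resolve_right hd0
  rw [hn, h3]
  simp

/-! ### Invariant graphs and the order on them. -/

theorem mem_cylGraph_iff {φ : ℝ → ℝ} (hφ : Function.Periodic φ 1) {x y : ℝ} :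
    cylProj (x, y) ∈ cylGraph φ ↔ y = φ x := by
  constructor
  · rintro ⟨x', -, h⟩
    obtain ⟨n, hn⟩ := cylProj_eq_iff.1 h
    rw [Prod.ext_iff] at hn
    simp only at hn
    have := hφ.int_mul n x
    rw [mul_one] at this
    rw [← hn.2, hn.1, this]
  · rintro rfl
    refine ⟨Int.fract x, ⟨Int.fract_nonneg x, (Int.fract_lt_one x).le⟩, ?_⟩
    rw [cylProj_eq_iff]
    refine ⟨-⌊x⌋, ?_⟩
    have := hφ.sub_int_mul_eq ⌊x⌋ (x := x)
    rw [mul_one] at this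
    simp only [Prod.mk.injEq]
    push_cast
    refine ⟨by rw [Int.fract]; ring, by rw [Int.fract, this]⟩

theorem IsCylLift.snd_apply_eq {f : Cylinder → Cylinder} {F : ℝ × ℝ → ℝ × ℝ} {φ : ℝ → ℝ}
    (hF : IsCylLift F f) (hφ : IsInvariantRotationalCircle f φ) (x : ℝ) :
    (F (x, φ x)).2 = φ (F (x, φ x)).1 := by
  rw [← mem_cylGraph_iff hφ.periodic, Prod.mk.eta, hF.2, ← hφ.invariant]
  exact mem_image_of_mem _ ((mem_cylGraph_iff hφ.periodic).2 rfl)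

theorem IsInvariantRotationalCircle.symm {f : Cylinder ≃ₜ Cylinder} {φ : ℝ → ℝ}
    (hφ : IsInvariantRotationalCircle f φ) : IsInvariantRotationalCircle f.symm φ := by
  refine ⟨hφ.continuous, hφ.periodic, ?_⟩
  conv_lhs => rw [← hφ.invariant]
  rw [← image_comp]
  simp

theorem det_eq_of_prod (A : ℝ × ℝ →L[ℝ] ℝ × ℝ) :
    A.det = (A (1, 0)).1 * (A (0, 1)).2 - (A (0, 1)).1 * (A (1, 0)).2 := by
  rw [ContinuousLinearMap.det, ← LinearMap.det_toMatrix (Module.Basis.finTwoProd ℝ),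
    Matrix.det_fin_two]
  simp [LinearMap.toMatrix_apply]

/-- The horizontal drift of vertical lines under the inverse of an orientation preserving twist map
is to the left. -/
theorem fst_apply_neg_of_comp_eq_id {A B : ℝ × ℝ →L[ℝ] ℝ × ℝ} (hAB : ∀ v, A (B v) = v)
    (hdet : 0 < A.det) (htw : 0 < (A (0, 1)).1) : (B (0, 1)).1 < 0 := by
  have h := hAB (0, 1)
  have hlin : A (B (0, 1)) = (B (0, 1)).1 • A (1, 0) + (B (0, 1)).2 • A (0, 1) := by
    rw [← map_smul, ← map_smul, ← map_add]
    congr 1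
    ext <;> simp
  rw [hlin, Prod.ext_iff] at h
  simp only [Prod.fst_add, Prod.smul_fst, smul_eq_mul, Prod.snd_add, Prod.smul_snd] at h
  rw [det_eq_of_prod] at hdet
  by_contra! hneg
  have h3 := mul_nonneg hneg hdet.le
  -- Cramer's rule for the equation `A (B (0, 1)) = (0, 1)`.
  have h4 : (B (0, 1)).1 * ((A (1, 0)).1 * (A (0, 1)).2 - (A (0, 1)).1 * (A (1, 0)).2)
      = -(A (0, 1)).1 := by
    linear_combination (A (0, 1)).2 * h.1 - (A (0, 1)).1 * h.2
  linarith

theorem strictMono_of_partial_pos {H : ℝ × ℝ → ℝ × ℝ} (hH : Differentiable ℝ H)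
    (hpos : ∀ p, 0 < (fderiv ℝ H p (0, 1)).1) (x : ℝ) : StrictMono fun y => (H (x, y)).1 := by
  refine strictMono_of_deriv_pos fun y => ?_
  have h1 : HasDerivAt (fun y : ℝ => (x, y)) (0, 1) y :=
    (hasDerivAt_const y x).prodMk (hasDerivAt_id y)
  have h2 := (hH (x, y)).hasFDerivAt.comp_hasDerivAt y h1
  have h3 := (ContinuousLinearMap.fst ℝ ℝ ℝ).hasFDerivAt.comp_hasDerivAt y h2
  have h4 : deriv (fun y => (H (x, y)).1) y = (fderiv ℝ H (x, y) (0, 1)).1 := h3.deriv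
  rw [h4]
  exact hpos _

theorem strictAnti_of_partial_neg {H : ℝ × ℝ → ℝ × ℝ} (hH : Differentiable ℝ H)
    (hneg : ∀ p, (fderiv ℝ H p (0, 1)).1 < 0) (x : ℝ) : StrictAnti fun y => (H (x, y)).1 := by
  refine strictAnti_of_deriv_neg fun y => ?_
  have h1 : HasDerivAt (fun y : ℝ => (x, y)) (0, 1) y :=
    (hasDerivAt_const y x).prodMk (hasDerivAt_id y)
  have h2 := (hH (x, y)).hasFDerivAt.comp_hasDerivAt y h1
  have h3 := (ContinuousLinearMap.fst ℝ ℝ ℝ).hasFDerivAt.comp_hasDerivAt y h2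
  have h4 : deriv (fun y => (H (x, y)).1) y = (fderiv ℝ H (x, y) (0, 1)).1 := h3.deriv
  rw [h4]
  exact hneg _

/-- Points that are mapped high enough lie high. -/
theorem exists_lt_snd_of_lt {f : Cylinder → Cylinder} (hf : Continuous f)
    (hbot : Tendsto (fun z => (f z).2) (comap Prod.snd atBot) atBot) (M : ℝ) :
    ∃ N : ℝ, ∀ z, N < (f z).2 → M < z.2 := by
  have h1 := hbot.eventually (eventually_le_atBot (0 : ℝ))
  rw [eventually_comap] at h1
  obtain ⟨L, hL⟩ := eventually_atBot.1 h1
  have hK : IsCompact ((univ : Set UnitAddCircle) ×ˢ Icc L M) := isCompact_univ.prod isCompact_Icc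
  obtain ⟨C, hC⟩ := hK.bddAbove_image (f := fun z => (f z).2) (by fun_prop)
  refine ⟨max 0 C, fun z hz => ?_⟩
  by_contra! hzM
  rcases le_total z.2 L with hzL | hzL
  · exact absurd (hL z.2 hzL z rfl) (not_le.2 ((le_max_left _ _).trans_lt hz))
  · exact absurd (hC (mem_image_of_mem _ (⟨mem_univ _, hzL, hzM⟩ : z ∈ univ ×ˢ Icc L M)))
      (not_le.2 ((le_max_right _ _).trans_lt hz))

theorem Function.Periodic.exists_le_of_continuous {φ : ℝ → ℝ} (hφ : Function.Periodic φ 1)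
    (hc : Continuous φ) : ∃ C, ∀ x, φ x ≤ C := by
  obtain ⟨C, hC⟩ := (isCompact_Icc (a := (0 : ℝ)) (b := 1)).bddAbove_image (f := φ) hc.continuousOn
  refine ⟨C, fun x => ?_⟩
  obtain ⟨y, hy, hxy⟩ := hφ.exists_mem_Ico₀ one_pos x
  rw [hxy]
  exact hC (mem_image_of_mem _ (Ico_subset_Icc_self hy))

/-- The lifting of the dynamics on an invariant rotational circle of a twist map preserves the
order of the line. -/
theorem strictMono_on_invariant_circle {f : Cylinder ≃ₜ Cylinder} (hf : IsTwistMap f)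
    {F G : ℝ × ℝ → ℝ × ℝ} {d : ℤ} (hF : IsCylLift F f) (hFc : ContDiff ℝ 1 F)
    (hG : IsCylLift G f.symm) (hGc : ContDiff ℝ 1 G) (hFG : ∀ p, F (G p) = p) (hd0 : d ≠ 0)
    (hd : ∀ (n : ℤ) (x y : ℝ), F (x + n, y) = ((F (x, y)).1 + n * d, (F (x, y)).2))
    {φ : ℝ → ℝ} (hφ : IsInvariantRotationalCircle f φ) :
    StrictMono fun x => (F (x, φ x)).1 := by
  have hFd := hFc.differentiable one_ne_zero
  have hGd := hGc.differentiable one_ne_zero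
  have hcont : Continuous fun x => (F (x, φ x)).1 :=
    continuous_fst.comp (hF.1.comp (continuous_id.prodMk hφ.continuous))
  have hinj : Function.Injective fun x => (F (x, φ x)).1 := by
    intro x x' h
    have h' : F (x, φ x) = F (x', φ x') :=
      Prod.ext h (by rw [hF.snd_apply_eq hφ, hF.snd_apply_eq hφ]; exact congrArg φ h)
    exact congrArg Prod.fst (hF.injective hd0 hd h')
  -- To exclude the decreasing case, compare the preimages of two points of the line `x = 0`: one on
  -- the circle and one far above it.
  refine (hcont.strictMono_of_inj hinj).resolve_right fun hanti => ?_
  have hGanti := strictAnti_of_partial_neg hGd fun p => by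
    refine fst_apply_neg_of_comp_eq_id (A := fderiv ℝ F (G p)) (fun v => ?_)
      (hf.orientation F hF _) (hf.twist F hF _)
    have h1 := (hFd (G p)).hasFDerivAt.comp p (hGd p).hasFDerivAt
    have h2 : F ∘ G = id := funext hFG
    rw [h2] at h1
    have h3 := h1.unique (hasFDerivAt_id p)
    exact DFunLike.congr_fun h3 v
  obtain ⟨C, hC⟩ := hφ.periodic.exists_le_of_continuous hφ.continuous
  obtain ⟨N, hN⟩ := exists_lt_snd_of_lt f.continuous hf.tendsto_bot C
  -- So high that the preimage of `(0, Y)` lies above the whole circle.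
  set Y := max N (φ 0) + 1 with hY
  have hYN : N < Y := (le_max_left _ _).trans_lt (lt_add_one _)
  have hYφ : φ 0 < Y := (le_max_right _ _).trans_lt (lt_add_one _)
  have hq : C < (G (0, Y)).2 := hN (cylProj (G (0, Y))) (by
    rw [← hF.2, hFG]
    exact hYN)
  have hlow := hG.snd_apply_eq hφ.symm 0
  have hx : (G (0, Y)).1 < (G (0, φ 0)).1 := hGanti 0 hYφ
  have h1 := hanti hx
  simp only at h1
  rw [← hlow, Prod.mk.eta, hFG] at h1
  -- The circle point below `G (0, Y)` is sent to the right of `0` by `hanti`, and to the left of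
  -- `0` by the twist.
  have h2 := strictMono_of_partial_pos hFd (hf.twist F hF) (G (0, Y)).1
    ((hC (G (0, Y)).1).trans_lt hq)
  simp only [Prod.mk.eta, hFG] at h2
  exact lt_asymm h1 h2

/-- One turn along the circle advances the increasing lifting by `d`, so `d` is positive. -/
theorem degree_eq_one_of_invariant_circle {f : Cylinder ≃ₜ Cylinder}
    {F : ℝ × ℝ → ℝ × ℝ} {d : ℤ} (hd1 : 0 < d → d = 1)
    (hd : ∀ (n : ℤ) (x y : ℝ), F (x + n, y) = ((F (x, y)).1 + n * d, (F (x, y)).2))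
    {φ : ℝ → ℝ} (hφ : IsInvariantRotationalCircle f φ)
    (hmono : StrictMono fun x => (F (x, φ x)).1) : d = 1 := by
  refine hd1 ?_
  have h1 : (F (0, φ 0)).1 < (F (0 + (1 : ℤ), φ (0 + (1 : ℤ)))).1 := hmono (by simp)
  rw [Int.cast_one, hφ.periodic 0, ← Int.cast_one, hd] at h1
  simpa using h1

/-! ### Circle maps induced on invariant circles. -/

/-- A lifting of a twist map together with the properties used in the study of the invariant
circles. -/
structure IsTwistLift (F : ℝ × ℝ → ℝ × ℝ) (f : Cylinder → Cylinder) : Prop where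
  isCylLift : IsCylLift F f
  add_one : ∀ x y, F (x + 1, y) = ((F (x, y)).1 + 1, (F (x, y)).2)
  twist : ∀ x, StrictMono fun y => (F (x, y)).1
  strictMono : ∀ φ, IsInvariantRotationalCircle f φ → StrictMono fun x => (F (x, φ x)).1

theorem IsTwistMap.exists_isTwistLift {f : Cylinder ≃ₜ Cylinder} (hf : IsTwistMap f)
    {φ : ℝ → ℝ} (hφ : IsInvariantRotationalCircle f φ) : ∃ F, IsTwistLift F f := by
  obtain ⟨F, G, d, hF, hFc, hG, hGc, hFG, hd0, hd1, hd⟩ :=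
    exists_lift_rightInverse hf.contDiff hf.contDiff_symm
  have hmono := fun ψ (hψ : IsInvariantRotationalCircle f ψ) =>
    strictMono_on_invariant_circle hf hF hFc hG hGc hFG hd0 hd hψ
  have h1 := degree_eq_one_of_invariant_circle hd1 hd hφ (hmono φ hφ)
  refine ⟨F, hF, fun x y => ?_, strictMono_of_partial_pos (hFc.differentiable one_ne_zero)
    (hf.twist F hF), hmono⟩
  simpa [h1] using hd 1 x y

/-- The lifting of the dynamics on an invariant rotational circle, as a lifting of a circle map of
degree one. -/
def IsTwistLift.circleLift {F : ℝ × ℝ → ℝ × ℝ} {f : Cylinder → Cylinder} (hF : IsTwistLift F f)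
    {φ : ℝ → ℝ} (hφ : IsInvariantRotationalCircle f φ) : CircleDeg1Lift where
  toFun x := (F (x, φ x)).1
  monotone' := (hF.strictMono φ hφ).monotone
  map_add_one' x := by rw [hφ.periodic x, hF.add_one]

section

variable {F : ℝ × ℝ → ℝ × ℝ} {f : Cylinder → Cylinder} (hF : IsTwistLift F f)
  {φ ψ : ℝ → ℝ} (hφ : IsInvariantRotationalCircle f φ) (hψ : IsInvariantRotationalCircle f ψ)

theorem IsTwistLift.circleLift_apply (x : ℝ) : hF.circleLift hφ x = (F (x, φ x)).1 := rfl

theorem IsTwistLift.continuous_circleLift : Continuous (hF.circleLift hφ) :=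
  continuous_fst.comp (hF.isCylLift.1.comp (continuous_id.prodMk hφ.continuous))

theorem IsTwistLift.strictMono_circleLift : StrictMono (hF.circleLift hφ) :=
  hF.strictMono φ hφ

theorem IsTwistLift.circleLift_lt (h : ∀ x, φ x < ψ x) (x : ℝ) :
    hF.circleLift hφ x < hF.circleLift hψ x :=
  hF.twist x (h x)

theorem IsTwistLift.apply_cylProj (x : ℝ) :
    f (cylProj (x, φ x)) = cylProj (hF.circleLift hφ x, φ (hF.circleLift hφ x)) := by
  rw [← hF.isCylLift.2, hF.circleLift_apply, ← hF.isCylLift.snd_apply_eq hφ]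

theorem IsTwistLift.iterate_apply_cylProj (n : ℕ) (x : ℝ) :
    f^[n] (cylProj (x, φ x)) =
      cylProj ((hF.circleLift hφ)^[n] x, φ ((hF.circleLift hφ)^[n] x)) := by
  induction n with
  | zero => rfl
  | succ n ih =>
    rw [Function.iterate_succ_apply', ih, hF.apply_cylProj hφ, Function.iterate_succ_apply']

theorem IsTwistLift.hasRotationNumberOn :
    HasRotationNumberOn f (cylGraph φ)
      (((hF.circleLift hφ).translationNumber : ℝ) : UnitAddCircle) := by
  have hper : Function.Periodic (fun x => ((hF.circleLift hφ x : ℝ) : UnitAddCircle)) 1 := by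
    intro x
    simp only [CircleDeg1Lift.map_add_one]
    exact unitAddCircle_coe_eq_iff.2 ⟨1, by simp⟩
  refine ⟨hper.lift, ?_, hF.circleLift hφ, hF.continuous_circleLift hφ,
    hF.strictMono_circleLift hφ, fun x => rfl, rfl⟩
  rintro _ ⟨x, -, rfl⟩
  rw [hF.apply_cylProj hφ]
  rfl

end

/-! ### Translation numbers of ordered liftings. -/

namespace CircleDeg1Lift

/-- The difference `g - f` is periodic, so it attains its minimum on one period. -/
theorem exists_pos_forall_add_le {f g : CircleDeg1Lift} (hf : Continuous f) (hg : Continuous g)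
    (h : ∀ x, f x < g x) : ∃ ε > 0, ∀ x, f x + ε ≤ g x := by
  obtain ⟨x₀, -, hx₀⟩ := (isCompact_Icc (a := (0 : ℝ)) (b := 1)).exists_isMinOn
    (nonempty_Icc.2 zero_le_one) (hg.sub hf).continuousOn
  refine ⟨g x₀ - f x₀, sub_pos.2 (h x₀), fun x => ?_⟩
  have h1 : g x₀ - f x₀ ≤ g (Int.fract x) - f (Int.fract x) :=
    hx₀ ⟨Int.fract_nonneg x, (Int.fract_lt_one x).le⟩
  have h2 := f.map_fract_sub_fract_eq x
  have h3 := g.map_fract_sub_fract_eq x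
  linarith

/-- The last application alone supplies the gap; monotonicity handles the earlier ones. -/
theorem pow_add_le_pow {f g : CircleDeg1Lift} {ε : ℝ} (hε : 0 ≤ ε) (h : ∀ x, f x + ε ≤ g x)
    {n : ℕ} (hn : 0 < n) (x : ℝ) : (f ^ n) x + ε ≤ (g ^ n) x := by
  obtain ⟨k, rfl⟩ := Nat.exists_eq_succ_of_ne_zero hn.ne'
  have h1 : (f ^ k) x ≤ (g ^ k) x :=
    pow_mono (f := f) (g := g) (fun y => (le_add_of_nonneg_right hε).trans (h y)) k x
  rw [pow_succ', pow_succ', mul_apply, mul_apply]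
  exact (add_le_add_left (f.monotone h1) ε).trans (h _)

theorem pow_lt_pow_of_lt {f g : CircleDeg1Lift} (hf : Continuous f) (hg : Continuous g)
    (h : ∀ x, f x < g x) {n : ℕ} (hn : 0 < n) (x : ℝ) : (f ^ n) x < (g ^ n) x := by
  obtain ⟨ε, hε, hfg⟩ := exists_pos_forall_add_le hf hg h
  linarith [pow_add_le_pow hε.le hfg hn x]

/-- If two continuous liftings are strictly ordered and have the same translation number, then this
number is rational. -/
theorem exists_mul_translationNumber_eq_int {f g : CircleDeg1Lift} (hf : Continuous f)
    (hg : Continuous g) (h : ∀ x, f x < g x) (heq : f.translationNumber = g.translationNumber) :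
    ∃ (q : ℕ) (p : ℤ), 0 < q ∧ q * f.translationNumber = p := by
  obtain ⟨ε, hε, hfg⟩ := exists_pos_forall_add_le hf hg h
  obtain ⟨n, hn⟩ := exists_nat_one_div_lt hε
  -- Dirichlet: some multiple `k * τ` is closer than the gap `ε` to an integer `p`.
  obtain ⟨p, k, hk0, -, hk⟩ :=
    Real.exists_int_int_abs_mul_sub_le f.translationNumber (n := n + 1) n.succ_pos
  lift k to ℕ using hk0.le
  have hk0 : 0 < k := by exact_mod_cast hk0
  refine ⟨k, p, hk0, ?_⟩
  have hlt : |(k : ℝ) * f.translationNumber - p| < ε := by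
    refine lt_of_le_of_lt (by exact_mod_cast hk) (lt_of_le_of_lt ?_ hn)
    push_cast
    apply one_div_le_one_div_of_le <;> linarith [n.cast_nonneg (α := ℝ)]
  have hgap := pow_add_le_pow hε.le hfg hk0
  have hτf := f.translationNumber_pow k
  have hτg := g.translationNumber_pow k
  rw [← heq] at hτg
  rw [abs_lt] at hlt
  rcases lt_trichotomy ((k : ℝ) * f.translationNumber) p with hlt' | heq' | hgt
  · have h1 := (g ^ k).map_lt_of_translationNumber_lt_int (hτg.trans_lt hlt')
    have h2 := (f ^ k).translationNumber_le_of_le_add (z := p - ε)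
      fun x => by linarith [hgap x, h1 x]
    linarith
  · exact heq'
  · have h1 := (f ^ k).lt_map_of_int_lt_translationNumber (hgt.trans_eq hτf.symm)
    have h2 := (g ^ k).le_translationNumber_of_add_le (z := p + ε)
      fun x => by linarith [hgap x, h1 x]
    linarith

/-- The translation number depends continuously on the lifting. -/
theorem continuous_translationNumber_of_continuous {T : Type*} [TopologicalSpace T]
    {g : T → CircleDeg1Lift} (hg : Continuous fun p : T × ℝ => g p.1 p.2) :
    Continuous fun t => (g t).translationNumber := by
  have hit : ∀ n : ℕ, Continuous fun t => (g t ^ n) 0 := by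
    intro n
    induction n with
    | zero => simpa using continuous_const
    | succ n ih =>
      simp only [pow_succ', mul_apply]
      exact hg.comp (continuous_id.prodMk ih)
  have hunif : TendstoUniformly (fun (n : ℕ) t => (g t ^ (n + 1)) 0 / (n + 1))
      (fun t => (g t).translationNumber) atTop := by
    rw [Metric.tendstoUniformly_iff]
    intro ε hε
    obtain ⟨N, hN⟩ := exists_nat_one_div_lt hε
    filter_upwards [eventually_ge_atTop N] with n hn t
    have h1 := (g t).dist_pow_map_zero_mul_translationNumber_le (n + 1)
    have hpos : (0 : ℝ) < n + 1 := by positivity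
    rw [Real.dist_eq] at h1 ⊢
    have h2 : (g t).translationNumber - (g t ^ (n + 1)) 0 / (n + 1)
        = -((g t ^ (n + 1)) 0 - ((n + 1 : ℕ) : ℝ) * (g t).translationNumber) / (n + 1) := by
      push_cast
      field_simp
      ring
    rw [h2, abs_div, abs_neg, abs_of_pos hpos]
    refine lt_of_le_of_lt ?_ hN
    refine (div_le_div_of_nonneg_right h1 hpos.le).trans ?_
    apply one_div_le_one_div_of_le
    · positivity
    · exact_mod_cast Nat.succ_le_succ hn
  exact hunif.continuous (Frequently.of_forall fun n => (hit (n + 1)).div_const _)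

end CircleDeg1Lift

/-! ### Area, recurrence and periodic points. -/

instance CylMetric.isLocallyFiniteMeasure_area (g : CylMetric) :
    IsLocallyFiniteMeasure g.area := by
  refine IsLocallyFiniteMeasure.withDensity_ofReal ?_
  exact Real.continuous_sqrt.comp g.continuous_gram.matrix_det

theorem CylMetric.area_pos (g : CylMetric) {V : Set Cylinder} (hV : IsOpen V)
    (hne : V.Nonempty) : g.area V ≠ 0 := by
  have hac : (volume : Measure Cylinder) ≪ g.area := by
    refine withDensity_absolutelyContinuous' ?_ (Eventually.of_forall fun z => ?_)
    · exact (ENNReal.continuous_ofReal.comp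
        (Real.continuous_sqrt.comp g.continuous_gram.matrix_det)).aemeasurable
    · exact (ENNReal.ofReal_pos.2 (Real.sqrt_pos.2 (g.posDef_gram z).det_pos)).ne'
  exact fun h => (hV.measure_pos volume hne).ne' (hac h)

/-- A homeomorphism that preserves the area of a metric and a compact set is recurrent on the open
subsets of this set. -/
theorem CylMetric.exists_mem_iterate_mem (g : CylMetric) {f : Cylinder ≃ₜ Cylinder}
    (hf : MeasurePreserving f g.area g.area) {K V : Set Cylinder} (hK : IsCompact K)
    (hfK : f '' K = K) (hV : IsOpen V) (hne : V.Nonempty) (hVK : V ⊆ K) (q : ℕ) :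
    ∃ z ∈ V, ∃ m ≠ 0, f^[q * m] z ∈ V := by
  have hpre : f ⁻¹' K = K := by
    conv_lhs => rw [← hfK]
    exact f.injective.preimage_image K
  have h1 := hf.restrict_preimage hK.measurableSet
  rw [hpre] at h1
  have : IsFiniteMeasure (g.area.restrict K) := ⟨by
    rw [Measure.restrict_apply_univ]
    exact hK.measure_lt_top⟩
  have h2 := h1.iterate q
  obtain ⟨z, hz, m, hm, hzm⟩ := h2.exists_mem_iterate_mem
    (s := V) hV.measurableSet.nullMeasurableSet (by
      rw [Measure.restrict_apply hV.measurableSet, inter_eq_left.2 hVK]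
      exact g.area_pos hV hne)
  exact ⟨z, hz, m, hm, by rwa [Function.iterate_mul]⟩

/-- The circles of a monotone family of invariant circles of an area preserving twist map do not all
have periodic points of the same type. -/
theorem IsTwistLift.exists_forall_pow_circleLift_ne {f : Cylinder ≃ₜ Cylinder}
    {F : ℝ × ℝ → ℝ × ℝ} (hF : IsTwistLift F f) {g : CylMetric}
    (harea : MeasurePreserving f g.area g.area) {ψ : ℝ → ℝ → ℝ}
    (hψ : Continuous fun p : ℝ × ℝ => ψ p.1 p.2)
    (hinv : ∀ u, IsInvariantRotationalCircle f (ψ u))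
    (hmono : ∀ x, StrictMonoOn (fun u => ψ u x) (Icc 0 1)) {q : ℕ} (hq : 0 < q) (p : ℤ) :
    ∃ u ∈ Icc (0 : ℝ) 1, ∀ x, (hF.circleLift (hinv u) ^ q) x ≠ x + p := by
  by_contra! hfix
  set P : ℝ → CircleDeg1Lift := fun u => hF.circleLift (hinv u) ^ q with hP
  have hPlt : ∀ u ∈ Icc (0 : ℝ) 1, ∀ v ∈ Icc (0 : ℝ) 1, u < v → ∀ x, P u x < P v x := by
    intro u hu v hv huv x
    exact CircleDeg1Lift.pow_lt_pow_of_lt (hF.continuous_circleLift _) (hF.continuous_circleLift _)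
      (fun y => hF.circleLift_lt _ _ (fun x => hmono x hu hv huv) y) hq x
  have h0 : (0 : ℝ) ∈ Icc (0 : ℝ) 1 := ⟨le_rfl, zero_le_one⟩
  have h1 : (1 : ℝ) ∈ Icc (0 : ℝ) 1 := ⟨zero_le_one, le_rfl⟩
  -- The circle at `1 / 2` makes the box uniform: it fixes a `b > a` such that every higher leaf
  -- moves `a` beyond `b + p`.
  have h2 : (1 / 2 : ℝ) ∈ Icc (0 : ℝ) 1 := by norm_num
  obtain ⟨a, ha⟩ := hfix 0 h0
  set b : ℝ := P (1 / 2) a - p with hb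
  have hab : a < b := by
    have := hPlt 0 h0 (1 / 2) h2 (by norm_num) a
    simp only [hP] at this hb ha
    linarith
  set W : Set (ℝ × ℝ) := {z | z.1 ∈ Ioo a b ∧ ψ (1 / 2) z.1 < z.2 ∧ z.2 < ψ 1 z.1} with hW
  have hψu : ∀ u, Continuous (ψ u) := fun u => (hinv u).continuous
  have hWo : IsOpen W := by
    have hlow : IsOpen {z : ℝ × ℝ | ψ (1 / 2) z.1 < z.2} :=
      isOpen_lt ((hψu _).comp continuous_fst) continuous_snd
    have hup : IsOpen {z : ℝ × ℝ | z.2 < ψ 1 z.1} :=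
      isOpen_lt continuous_snd ((hψu _).comp continuous_fst)
    exact (isOpen_Ioo.preimage continuous_fst).inter (hlow.inter hup)
  have hWne : W.Nonempty := by
    obtain ⟨x, hx⟩ := exists_between hab
    obtain ⟨y, hy⟩ := exists_between (hmono x h2 h1 (by norm_num))
    exact ⟨(x, y), hx, hy⟩
  have hWleaf : ∀ z ∈ W, ∃ u ∈ Ioo (1 / 2 : ℝ) 1, z.2 = ψ u z.1 := by
    rintro ⟨x, y⟩ ⟨-, hy⟩
    obtain ⟨u, hu, huy⟩ := intermediate_value_Ioo (f := fun u => ψ u x)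
      (by norm_num : (1 / 2 : ℝ) ≤ 1)
      (hψ.comp (continuous_id.prodMk continuous_const)).continuousOn hy
    exact ⟨u, hu, huy.symm⟩
  set K : Set Cylinder := (fun z : ℝ × ℝ => cylProj (z.2, ψ z.1 z.2)) '' (Icc 0 1 ×ˢ Icc 0 1)
    with hKdef
  have hKeq : K = ⋃ u ∈ Icc (0 : ℝ) 1, cylGraph (ψ u) := by
    ext z
    simp only [hKdef, cylGraph, mem_image, mem_iUnion, mem_prod, Prod.exists, exists_prop]
    constructor
    · rintro ⟨u, x, ⟨hu, hx⟩, rfl⟩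
      exact ⟨u, hu, x, hx, rfl⟩
    · rintro ⟨u, hu, x, hx, rfl⟩
      exact ⟨u, x, ⟨hu, hx⟩, rfl⟩
  have hK : IsCompact K := (isCompact_Icc.prod isCompact_Icc).image
    (continuous_cylProj.comp (continuous_snd.prodMk hψ))
  have hfK : f '' K = K := by
    rw [hKeq, image_iUnion₂]
    exact iUnion₂_congr fun u _ => (hinv u).invariant
  have hVK : cylProj '' W ⊆ K := by
    rintro _ ⟨⟨x, y⟩, hz, rfl⟩
    obtain ⟨u, hu, huy⟩ := hWleaf _ hz
    rw [hKeq]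
    refine mem_biUnion (x := u) ⟨by linarith [hu.1], hu.2.le⟩ ?_
    exact (mem_cylGraph_iff (hinv u).periodic).2 huy
  obtain ⟨_, ⟨⟨x, y⟩, hz, rfl⟩, m, hm, ⟨x', y'⟩, hz', hret⟩ :=
    g.exists_mem_iterate_mem harea hK hfK (isOpenMap_cylProj _ hWo) (hWne.image _) hVK q
  obtain ⟨u, hu, huy⟩ := hWleaf _ hz
  have huI : u ∈ Icc (0 : ℝ) 1 := ⟨by linarith [hu.1], hu.2.le⟩
  simp only at huy
  rw [huy, hF.iterate_apply_cylProj (hinv u), Function.iterate_mul, ← CircleDeg1Lift.coe_pow]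
    at hret
  obtain ⟨N, hN⟩ := cylProj_eq_iff.1 hret
  replace hN := congrArg Prod.fst hN
  change x' = (P u)^[m] x + N at hN
  have hub : b + p < P u a := by
    have := hPlt _ h2 u huI hu.1 a
    linarith
  obtain ⟨c₀, hc₀⟩ := hfix u huI
  change P u c₀ = c₀ + p at hc₀
  -- The barrier: an integer translate of the periodic point, within one period to the right of `a`.
  obtain ⟨c, hac, hca, hc⟩ : ∃ c, a ≤ c ∧ c < a + 1 ∧ P u c = c + p := by
    refine ⟨c₀ - ⌊c₀ - a⌋, ?_, ?_, ?_⟩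
    · linarith [Int.floor_le (c₀ - a)]
    · linarith [Int.lt_floor_add_one (c₀ - a)]
    · rw [CircleDeg1Lift.map_sub_int, hc₀]; ring
  have hbc : b < c := by
    have := (P u).monotone hac
    linarith
  have hup : (P u)^[m] x ≤ c + m * p := by
    rw [← (P u).iterate_eq_of_map_eq_add_int hc m]
    exact (P u).monotone.iterate m (hz.1.2.trans hbc).le
  have hlow : b + m * p ≤ (P u)^[m] x := by
    obtain ⟨k, rfl⟩ := Nat.exists_eq_succ_of_ne_zero hm
    refine le_trans ?_ ((P u).monotone.iterate _ hz.1.1.le)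
    rw [Function.iterate_succ_apply']
    have h3 := (P u).monotone ((P u).le_iterate_of_add_int_le_map
      (x := a) (m := p) (by linarith) k)
    have h4 := (P u).map_add_int a (k * p)
    push_cast at h4 ⊢
    rw [h4] at h3
    linarith
  have hx' : x' ∈ Ioo a b := hz'.1
  -- After subtracting `m * p` the orbit lies in `[b, c]` with `c < a + 1`, which misses all integer
  -- translates of `(a, b)`.
  have hint : (0 : ℝ) < ((1 + N + m * p : ℤ) : ℝ) → False := by
    intro hpos
    have : (0 : ℤ) ≤ N + m * p := by
      have : (0 : ℤ) < 1 + N + m * p := by exact_mod_cast hpos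
      linarith
    have h5 : (0 : ℝ) ≤ N + m * p := by exact_mod_cast this
    linarith [hx'.2]
  refine hint ?_
  push_cast
  linarith [hx'.1]

/-! ### Strict monotonicity of the rotation number. -/

theorem lt_of_disjoint_cylGraph {φ ψ : ℝ → ℝ} (hφ : Continuous φ) (hψ : Continuous ψ)
    (hφp : Function.Periodic φ 1) (hψp : Function.Periodic ψ 1)
    (hdisj : Disjoint (cylGraph φ) (cylGraph ψ)) {x : ℝ} (hx : φ x < ψ x) (y : ℝ) :
    φ y < ψ y := by
  have hne : ∀ z, φ z ≠ ψ z := fun z hz => disjoint_left.1 hdisj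
    ((mem_cylGraph_iff hφp (x := z)).2 rfl) ((mem_cylGraph_iff hψp).2 hz)
  by_contra! hy
  obtain ⟨z, hz⟩ := mem_range_of_exists_le_of_exists_ge (hφ.sub hψ) (c := 0)
    ⟨x, (sub_neg.2 hx).le⟩ ⟨y, sub_nonneg.2 hy⟩
  exact hne z (sub_eq_zero.1 hz)

/-- The rotation number strictly increases along a monotone family of invariant circles. -/
theorem IsTwistLift.translationNumber_circleLift_lt {f : Cylinder ≃ₜ Cylinder}
    {F : ℝ × ℝ → ℝ × ℝ} (hF : IsTwistLift F f) {g : CylMetric}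
    (harea : MeasurePreserving f g.area g.area) {ψ : ℝ → ℝ → ℝ}
    (hψ : Continuous fun p : ℝ × ℝ => ψ p.1 p.2)
    (hinv : ∀ u, IsInvariantRotationalCircle f (ψ u))
    (hmono : ∀ x, StrictMonoOn (fun u => ψ u x) (Icc 0 1)) :
    (hF.circleLift (hinv 0)).translationNumber < (hF.circleLift (hinv 1)).translationNumber := by
  have hτ : ∀ u ∈ Icc (0 : ℝ) 1, ∀ v ∈ Icc (0 : ℝ) 1, u ≤ v →
      (hF.circleLift (hinv u)).translationNumber ≤ (hF.circleLift (hinv v)).translationNumber :=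
    fun u hu v hv huv => CircleDeg1Lift.translationNumber_mono fun x =>
      (hF.twist x).monotone ((hmono x).monotoneOn hu hv huv)
  have h0 : (0 : ℝ) ∈ Icc (0 : ℝ) 1 := ⟨le_rfl, zero_le_one⟩
  have h1 : (1 : ℝ) ∈ Icc (0 : ℝ) 1 := ⟨zero_le_one, le_rfl⟩
  refine lt_of_le_of_ne (hτ 0 h0 1 h1 zero_le_one) fun heq => ?_
  -- Equal numbers at the ends are rational and, by monotonicity, shared by all circles between.
  obtain ⟨q, p, hq, hqp⟩ := CircleDeg1Lift.exists_mul_translationNumber_eq_int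
    (hF.continuous_circleLift (hinv 0)) (hF.continuous_circleLift (hinv 1))
    (hF.circleLift_lt _ _ fun x => hmono x h0 h1 zero_lt_one) heq
  obtain ⟨u, hu, hne⟩ := hF.exists_forall_pow_circleLift_ne harea hψ hinv hmono hq p
  have hu0 : (hF.circleLift (hinv u)).translationNumber
      = (hF.circleLift (hinv 0)).translationNumber :=
    le_antisymm ((hτ u hu 1 h1 hu.2).trans heq.ge) (hτ 0 h0 u hu hu.1)
  have hint : (hF.circleLift (hinv u) ^ q).translationNumber = p := by
    rw [CircleDeg1Lift.translationNumber_pow, hu0, hqp]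
  obtain ⟨x, hx⟩ := (CircleDeg1Lift.translationNumber_eq_int_iff _
    (CircleDeg1Lift.continuous_pow _ (hF.continuous_circleLift _) q)).1 hint
  exact hne x hx

theorem corollary7 (f : Cylinder ≃ₜ Cylinder) (hf : IsTwistMap f) (a b : ℝ)
    (φ : Icc a b → ℝ → ℝ) (hφ : Continuous fun p : Icc a b × ℝ => φ p.1 p.2)
    (hinv : ∀ t, IsInvariantRotationalCircle f (φ t))
    (hdisj : ∀ s t, s ≠ t → Disjoint (cylGraph (φ s)) (cylGraph (φ t))) :
    ∃ r : Icc a b → ℝ, Continuous r ∧ (StrictMono r ∨ StrictAnti r) ∧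
      ∀ t, HasRotationNumberOn f (cylGraph (φ t)) ((r t : ℝ) : UnitAddCircle) := by
  rcases lt_or_ge b a with hba | hab
  · have : IsEmpty (Icc a b) := by
      rw [Icc_eq_empty_of_lt hba]
      infer_instance
    exact ⟨isEmptyElim, continuous_of_const fun t => isEmptyElim t,
      Or.inl fun t => isEmptyElim t, isEmptyElim⟩
  obtain ⟨F, hF⟩ := hf.exists_isTwistLift (hinv ⟨a, left_mem_Icc.2 hab⟩)
  obtain ⟨g, harea⟩ := hf.area
  have hne : ∀ x s t, s ≠ t → φ s x ≠ φ t x := fun x s t hst h =>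
    disjoint_left.1 (hdisj s t hst) ((mem_cylGraph_iff (hinv s).periodic (x := x)).2 rfl)
      ((mem_cylGraph_iff (hinv t).periodic).2 h)
  have hcont : ∀ x, Continuous fun t => φ t x := fun x =>
    hφ.comp (continuous_id.prodMk continuous_const)
  set r : Icc a b → ℝ := fun t => (hF.circleLift (hinv t)).translationNumber with hr
  have key : ∀ s t, φ s 0 < φ t 0 → r s < r t := by
    intro s t hst
    have hst' : (s : ℝ) ≠ t := fun h => hst.ne (by rw [Subtype.ext h])
    -- Runs from `s` to `t`, whichever is larger; `projIcc` only serves to define it for all real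
    -- `u`.
    set c : ℝ → Icc a b := fun u => projIcc a b hab (AffineMap.lineMap (s : ℝ) (t : ℝ) u) with hc
    have hcc : Continuous c := continuous_projIcc.comp AffineMap.lineMap_continuous
    have hc0 : c 0 = s := by simp [hc]
    have hc1 : c 1 = t := by simp [hc]
    have hcinj : InjOn c (Icc 0 1) := by
      have hmaps : ∀ u ∈ Icc (0 : ℝ) 1, AffineMap.lineMap (s : ℝ) (t : ℝ) u ∈ Icc a b :=
        fun u hu => (convex_Icc a b).lineMap_mem s.2 t.2 hu
      intro u hu v hv huv
      simp only [hc, projIcc_of_mem hab (hmaps u hu), projIcc_of_mem hab (hmaps v hv),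
        Subtype.mk.injEq] at huv
      exact AffineMap.lineMap_injective ℝ hst' huv
    have h := hF.translationNumber_circleLift_lt harea (ψ := fun u => φ (c u))
      (hφ.comp ((hcc.comp continuous_fst).prodMk continuous_snd)) (fun u => hinv (c u))
      fun x => ContinuousOn.strictMonoOn_of_injOn_Icc zero_le_one
        (by
          rw [hc0, hc1]
          exact (lt_of_disjoint_cylGraph (hinv s).continuous (hinv t).continuous
            (hinv s).periodic (hinv t).periodic
            (hdisj s t fun h => hst' (congrArg Subtype.val h)) hst x).le)
        ((hcont x).comp hcc).continuousOn
        fun u hu v hv huv => hcinj hu hv (by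
          by_contra hcne
          exact hne x _ _ hcne huv)
    change r (c 0) < r (c 1) at h
    rwa [hc0, hc1] at h
  refine ⟨r, ?_, ?_, fun t => hF.hasRotationNumberOn (hinv t)⟩
  · exact CircleDeg1Lift.continuous_translationNumber_of_continuous
      (g := fun t => hF.circleLift (hinv t))
      (continuous_fst.comp (hF.isCylLift.1.comp (continuous_snd.prodMk hφ)))
  · have : Fact (a ≤ b) := ⟨hab⟩
    -- The height over `0` is continuous and injective in `t`, hence strictly monotone, and `key`
    -- passes this on to `r`.
    have hinj : Function.Injective fun t => φ t 0 := fun s t h => by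
      by_contra hst
      exact hne 0 s t hst h
    exact ((hcont 0).strictMono_of_inj_boundedOrder' hinj).imp
      (fun h s t hst => key s t (h hst)) (fun h s t hst => key t s (h hst))
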